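/- Let $\Omega=(0,\pi)^2$, $\Gamma=\partial\Omega$ with exterior unit normal $\nu$, $\Gamma_1=(0,\pi)\times\{0,\pi\}$, $\Gamma_2=\{0,\pi\}\times(0,\pi)$. Let $\rho,a,\mu,\delta>0$ and let $\lambda,\beta,a_1,\dots,a_5,m_1,m_2$ be real. Put $b_1=2(a_1+a_2+a_3+a_4+a_5)$, $b_2=2(a_1+a_2+2a_3+2a_4+a_5)$, $b_3=2(a_3+a_4)$, $b_4=b_5=2(a_1+a_2+a_5)$. Consider the type III thermoelastic system of an isotropic nonsimple material without elastic damping $$\begin{aligned} \rho\ddot u_1&=(\lambda+2\mu)u_{1,11}+\mu u_{1,22}+(\lambda+\mu)u_{2,12}-\beta\dot\tau_{,1}-b_1u_{1,1111}-b_2u_{1,1122}-b_3u_{1,2222}\\&\quad-b_4u_{2,1112}-b_5u_{2,1222}-(m_1+2m_2)(\tau_{,111}+\tau_{,122}),\\ \rho\ddot u_2&=(\lambda+2\mu)u_{2,22}+\mu u_{2,11}+(\lambda+\mu)u_{1,12}-\beta\dot\tau_{,2}-b_1u_{2,2222}-b_2u_{2,1122}-b_3u_{2,1111}\\&\quad-b_4u_{1,1112}-b_5u_{1,1222}-(m_1+2m_2)(\tau_{,112}+\tau_{,222}),\\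 a\ddot\tau&=(m_1+2m_2)(u_{1,111}+u_{1,122}+u_{2,112}+u_{2,222})+\tau_{,11}+\tau_{,22}-\beta(\dot u_{1,1}+\dot u_{2,2})+\delta(\dot\tau_{,11}+\dot\tau_{,22}) \end{aligned}$$ in $\Omega\times(0,\infty)$. With $\kappa_{IJK}=u_{K,IJ}$ and $$\begin{aligned}\sigma_{IJK}&=\tfrac12a_1(\delta_{JK}\kappa_{LLI}+2\delta_{IJ}\kappa_{KLL}+\delta_{IK}\kappa_{LLJ})+a_2(\delta_{JK}\kappa_{ILL}+\delta_{IK}\kappa_{JLL})+2a_3\delta_{IJ}\kappa_{LLK}+2a_4\kappa_{IJK}\\&\quad+a_5(\kappa_{KJI}+\kappa_{KIJ})+m_1\delta_{IJ}\tau_{,K}+m_2(\delta_{JK}\tau_{,I}+\delta_{IK}\tau_{,J})\end{aligned}$$ (summation over repeated indices $L$) impose $$\sigma_{111}=\sigma_{221}=\sigma_{122}=0,\quad(\sigma_{112,1},\sigma_{222,2})\cdot\nu=0\ \text{ on }\Gamma,\qquad\tau=0\ \text{ on }\Gamma_1,\quad\nabla\tau\cdot\nu=0\ \text{ on }\Gamma_2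 .$$ Let $\mathcal H_*=(H^2(\Omega)/\{1\})^2\times(L^2(\Omega)/\{1\})^2\times(H^1(\Omega)/\{1\})\times(L^2(\Omega)/\{1\})$ be the complex Hilbert space of $U=(u_1,u_2,v_1,v_2,\tau,\theta)$ all of whose components have mean zero, with the canonical inner product. Let $\mathcal A$ be the operator on $\mathcal H_*$ for which $\dot U=\mathcal AU$ is the above system written with $v=\dot u$, $\theta=\dot\tau$; its domain consists of all $U\in\mathcal H_*$ with $u\in H^4$, $v\in H^2$, $\tau\in H^3$, $\theta\in H^2$ that satisfy the boundary conditions (those for $\tau$ also with $\theta$ in place of $\tau$, all in the sense of traces) and $\mathcal AU\in\mathcal H_*$. A classical solution is a $U\in C^1([0,\infty),\mathcal H_*)$ with $U(t)\in D(\mathcal A)$ and $\dot U(t)=\mathcal AU(t)$ for all $t\ge0$. **Theorem.** If $a_3+a_4\ge0$, then the system is not exponentially stable: (i) there are no $M,\omega>0$ such that $\|U(t)\|\le Me^{-\omega t}\|U(0)\|$ for all classical solutions $U$ and all $t\ge0$; (ii) no $C_0$-semigroup $(S(t))_{t\ge0}$ on $\mathcal H_*$ with $U(t)=S(t)U(0)$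 for every classical solution $U$ and every $t\ge0$ (in particular, no $C_0$-semigroup whose generator is $\mathcal A$ or an extension of $\mathcal A$) satisfies $\|S(t)\|\le Me^{-\omega t}$ for all $t\ge0$ with some $M,\omega>0$; (iii) there are $\lambda_n\in\mathbb R$ with $|\lambda_n|\to\infty$, $U_n\in D(\mathcal A)$ and a bounded sequence $(F_n)$ in $\mathcal H_*$ such that $(\mathrm i\lambda_n-\mathcal A)U_n=F_n$ for all $n$ and $\|U_n\|_{\mathcal H_*}\to\infty$. -/

import Mathlib

open MeasureTheory Filter Topology Set
open scoped ContDiff NNReal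

noncomputable section

namespace Nonsimple

/-- The rectangular body `Ω = (0, π) × (0, π)`. -/
def Square : Set (ℝ × ℝ) := Ioo 0 Real.pi ×ˢ Ioo 0 Real.pi

/-- The complex Lebesgue space `L²(Ω)`. -/
abbrev L2 : Type := Lp ℂ 2 ((volume : Measure (ℝ × ℝ)).restrict Square)

/-! ### Weak derivatives and Sobolev spaces -/

/-- The two coordinate directions (`0` is the direction of `x₁`, `1` that of `x₂`). -/
def dir : Fin 2 → ℝ × ℝ := ![(1, 0), (0, 1)]

/-- Classical partial derivative in the direction `i`. -/
def pd (i : Fin 2) (φ : ℝ × ℝ → ℂ) : ℝ × ℝ → ℂ := fun x => fderiv ℝ φ x (dir i)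

/-- Classical derivative `∂₁^{α₁} ∂₂^{α₂} φ`. -/
def pdMulti (α : ℕ × ℕ) (φ : ℝ × ℝ → ℂ) : ℝ × ℝ → ℂ := (pd 0)^[α.1] ((pd 1)^[α.2] φ)

/-- Smooth functions with compact support inside the set `W`. -/
def IsTest (W : Set (ℝ × ℝ)) (φ : ℝ × ℝ → ℂ) : Prop :=
  ContDiff ℝ ∞ φ ∧ HasCompactSupport φ ∧ tsupport φ ⊆ W

/-- `g` is the weak derivative `∂^α f` on `Ω`. -/
def IsWeakDeriv (α : ℕ × ℕ) (f g : L2) : Prop :=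
  ∀ φ : ℝ × ℝ → ℂ, IsTest Square φ →
    ∫ x in Square, f x * pdMulti α φ x = (-1) ^ (α.1 + α.2) * ∫ x in Square, g x * φ x

lemma pd_contDiff (i : Fin 2) {φ : ℝ × ℝ → ℂ} (h : ContDiff ℝ ∞ φ) : ContDiff ℝ ∞ (pd i φ) := by
  unfold pd
  exact (h.fderiv_right (m := ∞) (by simp)).clm_apply contDiff_const

lemma pd_compact (i : Fin 2) {φ : ℝ × ℝ → ℂ} (h : HasCompactSupport φ) :
    HasCompactSupport (pd i φ) :=
  h.fderiv_apply (𝕜 := ℝ) (dir i)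

lemma pd_iter (i : Fin 2) (n : ℕ) {φ : ℝ × ℝ → ℂ} (h : ContDiff ℝ ∞ φ)
    (hc : HasCompactSupport φ) :
    ContDiff ℝ ∞ ((pd i)^[n] φ) ∧ HasCompactSupport ((pd i)^[n] φ) := by
  induction n with
  | zero => exact ⟨h, hc⟩
  | succ n ih =>
    rw [Function.iterate_succ_apply']
    exact ⟨pd_contDiff i ih.1, pd_compact i ih.2⟩

lemma pdMulti_test (α : ℕ × ℕ) {φ : ℝ × ℝ → ℂ} (h : ContDiff ℝ ∞ φ)
    (hc : HasCompactSupport φ) :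
    ContDiff ℝ ∞ (pdMulti α φ) ∧ HasCompactSupport (pdMulti α φ) := by
  obtain ⟨h1, h2⟩ := pd_iter 1 α.2 h hc
  exact pd_iter 0 α.1 h1 h2

lemma integrable_mul_test (f : L2) {φ : ℝ × ℝ → ℂ} (h : ContDiff ℝ ∞ φ)
    (hc : HasCompactSupport φ) : Integrable (fun x => f x * φ x) (volume.restrict Square) :=
  (Lp.memLp f).integrable_mul (q := 2) (h.continuous.memLp_of_hasCompactSupport hc)

lemma integral_add_mul (f g : L2) {φ : ℝ × ℝ → ℂ} (h : ContDiff ℝ ∞ φ)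
    (hc : HasCompactSupport φ) :
    ∫ x in Square, (f + g : L2) x * φ x
      = (∫ x in Square, f x * φ x) + ∫ x in Square, g x * φ x := by
  rw [← integral_add (integrable_mul_test f h hc) (integrable_mul_test g h hc)]
  refine integral_congr_ae ?_
  filter_upwards [Lp.coeFn_add f g] with x hx
  rw [hx, Pi.add_apply, add_mul]

lemma integral_smul_mul (c : ℂ) (f : L2) (φ : ℝ × ℝ → ℂ) :
    ∫ x in Square, (c • f : L2) x * φ x = c * ∫ x in Square, f x * φ x := by
  rw [← integral_const_mul]
  refine integral_congr_ae ?_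
  filter_upwards [Lp.coeFn_smul c f] with x hx
  rw [hx, Pi.smul_apply, smul_eq_mul, mul_assoc]

lemma integral_zero_mul (φ : ℝ × ℝ → ℂ) : ∫ x in Square, (0 : L2) x * φ x = 0 := by
  simpa using integral_smul_mul 0 0 φ

/-- Multi-indices of order at most `k`. -/
abbrev MultiIndex (k : ℕ) : Type :=
  {α : Fin (k + 1) × Fin (k + 1) // (α.1 : ℕ) + (α.2 : ℕ) ≤ k}

/-- The multi-index `0`. -/
def MultiIndex.zero (k : ℕ) : MultiIndex k := ⟨(0, 0), by simp⟩

/-- The Sobolev space `H^k(Ω)`; an element is the family of all weak derivatives of order at most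
`k` of its entry of order `0`, and `‖F‖² = ∑_{|α| ≤ k} ‖∂^α F‖²`. -/
def Sobolev (k : ℕ) : Submodule ℂ (PiLp 2 (fun _ : MultiIndex k => L2)) where
  carrier := {F | ∀ α : MultiIndex k,
    IsWeakDeriv ((α.1.1 : ℕ), (α.1.2 : ℕ)) (F (MultiIndex.zero k)) (F α)}
  add_mem' := by
    intro F G hF hG α φ hφ
    have ht := pdMulti_test ((α.1.1 : ℕ), (α.1.2 : ℕ)) hφ.1 hφ.2.1
    rw [PiLp.add_apply, PiLp.add_apply, integral_add_mul _ _ ht.1 ht.2,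
      integral_add_mul _ _ hφ.1 hφ.2.1, hF α φ hφ, hG α φ hφ, mul_add]
  zero_mem' := by
    intro α φ hφ
    rw [PiLp.zero_apply, PiLp.zero_apply, integral_zero_mul, integral_zero_mul, mul_zero]
  smul_mem' := by
    intro c F hF α φ hφ
    rw [PiLp.smul_apply, PiLp.smul_apply, integral_smul_mul, integral_smul_mul, hF α φ hφ]
    ring

/-- Families whose entry of order `0` has mean zero over `Ω`. -/
def MeanZero (k : ℕ) : Submodule ℂ (PiLp 2 (fun _ : MultiIndex k => L2)) where
  carrier := {F | ∫ x in Square, F (MultiIndex.zero k) x = 0}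
  add_mem' := by
    intro F G hF hG
    have : IsFiniteMeasure ((volume : Measure (ℝ × ℝ)).restrict Square) :=
      isFiniteMeasure_restrict.2 (by
        rw [Square, Measure.volume_eq_prod, Measure.prod_prod]
        simp [ENNReal.mul_eq_top])
    have hi : ∀ f : L2, Integrable f ((volume : Measure (ℝ × ℝ)).restrict Square) :=
      fun f => (Lp.memLp f).integrable (by norm_num)
    simp only [mem_ofPred_eq, PiLp.add_apply] at hF hG ⊢
    rw [integral_congr_ae (Lp.coeFn_add _ _), integral_add' (hi _) (hi _), hF, hG, add_zero]
  zero_mem' := by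
    simpa using integral_zero_mul (fun _ => 1)
  smul_mem' := by
    intro c F hF
    simp only [mem_ofPred_eq, PiLp.smul_apply] at hF ⊢
    simpa [hF] using integral_smul_mul c (F (MultiIndex.zero k)) (fun _ => 1)

/-- `H^k(Ω)/{1}`: the orthogonal complement of the constants in `H^k(Ω)`. -/
abbrev SobolevStar (k : ℕ) : Submodule ℂ (PiLp 2 (fun _ : MultiIndex k => L2)) :=
  Sobolev k ⊓ MeanZero k

/-- The weak derivative `∂^α f` of `f ∈ H^k(Ω)`, for `|α| ≤ k`. -/
def D {k : ℕ} (α : ℕ × ℕ) (f : Sobolev k) : L2 :=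
  if h : α.1 + α.2 ≤ k then f.1 ⟨(⟨α.1, by omega⟩, ⟨α.2, by omega⟩), h⟩ else 0

/-- The function underlying an element of `H^k(Ω)/{1}`. -/
def fn {k : ℕ} (f : SobolevStar k) : L2 := f.1 (MultiIndex.zero k)

/-! ### Vanishing boundary values

`Γ₁ = (0, π) × {0, π}` and `Γ₂ = {0, π} × (0, π)`.  The trace of `f ∈ H¹(Ω)` on a part of the
boundary is zero exactly when there is no boundary term in the integration by parts against
smooth functions that may be nonzero on that part. -/

/-- `f ∈ H¹(Ω)` has zero trace on `Γ₁`; here `f₂` stands for the weak derivative `f_{,2}`. -/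
def VanishesOnΓ₁ (f f₂ : L2) : Prop :=
  ∀ ψ : ℝ × ℝ → ℂ, IsTest (Ioo 0 Real.pi ×ˢ univ) ψ →
    ∫ x in Square, f x * pd 1 ψ x = - ∫ x in Square, f₂ x * ψ x

/-- `f ∈ H¹(Ω)` has zero trace on `Γ₂`; here `f₁` stands for the weak derivative `f_{,1}`. -/
def VanishesOnΓ₂ (f f₁ : L2) : Prop :=
  ∀ ψ : ℝ × ℝ → ℂ, IsTest (univ ×ˢ Ioo 0 Real.pi) ψ →
    ∫ x in Square, f x * pd 0 ψ x = - ∫ x in Square, f₁ x * ψ x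

/-! ### The material -/

/-- Material constants: Lamé moduli `lam`, `mu`, density `rho`, thermal capacity `a`, coupling
constants `beta`, `m₁`, `m₂`, strain gradient moduli `a₁, …, a₅`, thermal damping `delta`. -/
structure Material where
  lam : ℝ
  mu : ℝ
  rho : ℝ
  a : ℝ
  beta : ℝ
  delta : ℝ
  a₁ : ℝ
  a₂ : ℝ
  a₃ : ℝ
  a₄ : ℝ
  a₅ : ℝ
  m₁ : ℝ
  m₂ : ℝ

namespace Material

variable (c : Material)

def b₁ : ℝ := 2 * (c.a₁ + c.a₂ + c.a₃ + c.a₄ + c.a₅)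
def b₂ : ℝ := 2 * (c.a₁ + c.a₂ + 2 * c.a₃ + 2 * c.a₄ + c.a₅)
def b₃ : ℝ := 2 * (c.a₃ + c.a₄)
def b₄ : ℝ := 2 * (c.a₁ + c.a₂ + c.a₅)
def b₅ : ℝ := 2 * (c.a₁ + c.a₂ + c.a₅)

/-- The unit multi-indices. -/
def e : Fin 2 → ℕ × ℕ := ![(1, 0), (0, 1)]

/-- Kronecker's delta. -/
def kron (I J : Fin 2) : ℝ := if I = J then 1 else 0

/-- The derivative `∂^α σ_{IJK}` of the hyperstress tensor, with `κ_{IJK} = u_{K,IJ}` and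
`σ_{IJK} = a₁/2 (δ_{JK} κ_{LLI} + 2 δ_{IJ} κ_{KLL} + δ_{IK} κ_{LLJ})
  + a₂ (δ_{JK} κ_{ILL} + δ_{IK} κ_{JLL}) + 2 a₃ δ_{IJ} κ_{LLK} + 2 a₄ κ_{IJK}
  + a₅ (κ_{KJI} + κ_{KIJ}) + m₁ δ_{IJ} τ_{,K} + m₂ (δ_{JK} τ_{,I} + δ_{IK} τ_{,J})`. -/
def hyperstress (u : Fin 2 → Sobolev 4) (τ : Sobolev 3) (I J K : Fin 2) (α : ℕ × ℕ) : L2 :=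
  let κ : Fin 2 → Fin 2 → Fin 2 → L2 := fun P Q R => D (α + e P + e Q) (u R)
  (c.a₁ / 2) • (kron J K • ∑ L, κ L L I + (2 * kron I J) • ∑ L, κ K L L
      + kron I K • ∑ L, κ L L J)
    + c.a₂ • (kron J K • ∑ L, κ I L L + kron I K • ∑ L, κ J L L)
    + (2 * c.a₃ * kron I J) • ∑ L, κ L L K
    + (2 * c.a₄) • κ I J K
    + c.a₅ • (κ K J I + κ K I J)
    + (c.m₁ * kron I J) • D (α + e K) τ
    + c.m₂ • (kron J K • D (α + e I) τ + kron I K • D (α + e J) τ)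

/-- `ρ ü₁` according to the first balance equation. -/
def force₁ (u : Fin 2 → Sobolev 4) (τ : Sobolev 3) (θ : Sobolev 2) : L2 :=
  (c.lam + 2 * c.mu) • D (2, 0) (u 0) + c.mu • D (0, 2) (u 0) + (c.lam + c.mu) • D (1, 1) (u 1)
    - c.beta • D (1, 0) θ
    - c.b₁ • D (4, 0) (u 0) - c.b₂ • D (2, 2) (u 0) - c.b₃ • D (0, 4) (u 0)
    - c.b₄ • D (3, 1) (u 1) - c.b₅ • D (1, 3) (u 1)
    - (c.m₁ + 2 * c.m₂) • (D (3, 0) τ + D (1, 2) τ)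

/-- `ρ ü₂` according to the second balance equation. -/
def force₂ (u : Fin 2 → Sobolev 4) (τ : Sobolev 3) (θ : Sobolev 2) : L2 :=
  (c.lam + 2 * c.mu) • D (0, 2) (u 1) + c.mu • D (2, 0) (u 1) + (c.lam + c.mu) • D (1, 1) (u 0)
    - c.beta • D (0, 1) θ
    - c.b₁ • D (0, 4) (u 1) - c.b₂ • D (2, 2) (u 1) - c.b₃ • D (4, 0) (u 1)
    - c.b₄ • D (3, 1) (u 0) - c.b₅ • D (1, 3) (u 0)
    - (c.m₁ + 2 * c.m₂) • (D (2, 1) τ + D (0, 3) τ)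

/-- `a τ̈` according to the heat equation of type III. -/
def heat (u : Fin 2 → Sobolev 4) (v : Fin 2 → Sobolev 2) (τ : Sobolev 3) (θ : Sobolev 2) : L2 :=
  (c.m₁ + 2 * c.m₂) • (D (3, 0) (u 0) + D (1, 2) (u 0) + D (2, 1) (u 1) + D (0, 3) (u 1))
    + D (2, 0) τ + D (0, 2) τ
    - c.beta • (D (1, 0) (v 0) + D (0, 1) (v 1))
    + c.delta • (D (2, 0) θ + D (0, 2) θ)

/-- The boundary conditions on `Γ` for the elastic part:
`σ₁₁₁ = σ₂₂₁ = σ₁₂₂ = 0` and `(σ_{112,1}, σ_{222,2}) · ν = 0`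
(`ν = (±1, 0)` on `Γ₂` and `ν = (0, ±1)` on `Γ₁`). -/
def ElasticBC (u : Fin 2 → Sobolev 4) (τ : Sobolev 3) : Prop :=
  (VanishesOnΓ₁ (c.hyperstress u τ 0 0 0 (0, 0)) (c.hyperstress u τ 0 0 0 (0, 1)) ∧
    VanishesOnΓ₂ (c.hyperstress u τ 0 0 0 (0, 0)) (c.hyperstress u τ 0 0 0 (1, 0))) ∧
  (VanishesOnΓ₁ (c.hyperstress u τ 1 1 0 (0, 0)) (c.hyperstress u τ 1 1 0 (0, 1)) ∧
    VanishesOnΓ₂ (c.hyperstress u τ 1 1 0 (0, 0)) (c.hyperstress u τ 1 1 0 (1, 0))) ∧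
  (VanishesOnΓ₁ (c.hyperstress u τ 0 1 1 (0, 0)) (c.hyperstress u τ 0 1 1 (0, 1)) ∧
    VanishesOnΓ₂ (c.hyperstress u τ 0 1 1 (0, 0)) (c.hyperstress u τ 0 1 1 (1, 0))) ∧
  (VanishesOnΓ₁ (c.hyperstress u τ 1 1 1 (0, 1)) (c.hyperstress u τ 1 1 1 (0, 2)) ∧
    VanishesOnΓ₂ (c.hyperstress u τ 0 0 1 (1, 0)) (c.hyperstress u τ 0 0 1 (2, 0)))

/-- The thermal boundary conditions: `τ = 0` on `Γ₁` and `∇τ · ν = 0` on `Γ₂`. -/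
def ThermalBC {k : ℕ} (τ : Sobolev k) : Prop :=
  VanishesOnΓ₁ (D (0, 0) τ) (D (0, 1) τ) ∧ VanishesOnΓ₂ (D (1, 0) τ) (D (2, 0) τ)

end Material

/-! ### The state space, the operator and its evolution -/

/-- Sobolev orders of the components `u₁, u₂, v₁, v₂, τ, θ`. -/
def order : Fin 6 → ℕ := ![2, 2, 0, 0, 1, 0]

/-- The state space
`ℋ⁎ = (H²(Ω)/{1})² × (L²(Ω)/{1})² × (H¹(Ω)/{1}) × (L²(Ω)/{1})`
of all `U = (u₁, u₂, v₁, v₂, τ, θ)`, with its canonical inner product. -/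
abbrev State : Type := PiLp 2 (fun i : Fin 6 => SobolevStar (order i))

/-- `U ∈ D(𝒜)` and `𝒜 U = F`. -/
def IsImage (c : Material) (U F : State) : Prop :=
  ∃ (u : Fin 2 → Sobolev 4) (v : Fin 2 → Sobolev 2) (τ : Sobolev 3) (θ : Sobolev 2),
    (D (0, 0) (u 0) = fn (U 0) ∧ D (0, 0) (u 1) = fn (U 1) ∧
      D (0, 0) (v 0) = fn (U 2) ∧ D (0, 0) (v 1) = fn (U 3) ∧
      D (0, 0) τ = fn (U 4) ∧ D (0, 0) θ = fn (U 5)) ∧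
    c.ElasticBC u τ ∧ Material.ThermalBC τ ∧ Material.ThermalBC θ ∧
    (fn (F 0) = D (0, 0) (v 0) ∧ fn (F 1) = D (0, 0) (v 1) ∧
      fn (F 2) = (1 / c.rho) • c.force₁ u τ θ ∧ fn (F 3) = (1 / c.rho) • c.force₂ u τ θ ∧
      fn (F 4) = D (0, 0) θ ∧ fn (F 5) = (1 / c.a) • c.heat u v τ θ)

/-- Classical solutions on `[0, ∞)`: `U ∈ C¹([0, ∞), ℋ⁎) ∩ C⁰([0, ∞), D(𝒜))` and `U' = 𝒜 U`. -/
def IsClassicalSolution (c : Material) (U : ℝ → State) : Prop :=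
  ∃ U' : ℝ → State, ContinuousOn U' (Ici 0) ∧
    ∀ t ∈ Ici (0 : ℝ), HasDerivWithinAt U (U' t) (Ici 0) t ∧ IsImage c (U t) (U' t)

/-- The system is exponentially stable: all classical solutions decay at a common exponential
rate, with a common constant. -/
def SystemExpStable (c : Material) : Prop :=
  ∃ M > (0 : ℝ), ∃ r > (0 : ℝ), ∀ U : ℝ → State, IsClassicalSolution c U →
    ∀ t ≥ (0 : ℝ), ‖U t‖ ≤ M * Real.exp (-r * t) * ‖U 0‖

/-- `S` is a `C₀`-semigroup of bounded linear operators on `ℋ⁎`. -/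
structure IsC0Semigroup (S : ℝ≥0 → State →L[ℂ] State) : Prop where
  zero : S 0 = ContinuousLinearMap.id ℂ State
  add : ∀ s t, S (s + t) = (S s).comp (S t)
  continuous : ∀ x, Continuous fun t => S t x

/-- The classical solutions of the system are orbits of `S`.  Every `C₀`-semigroup whose generator
is `𝒜` or an extension of `𝒜` has this property. -/
def GovernsSystem (c : Material) (S : ℝ≥0 → State →L[ℂ] State) : Prop :=
  ∀ U : ℝ → State, IsClassicalSolution c U → ∀ t : ℝ≥0, U t = S t (U 0)

/-- Exponential stability of a semigroup. -/
def ExpStable (S : ℝ≥0 → State →L[ℂ] State) : Prop :=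
  ∃ M > (0 : ℝ), ∃ r > (0 : ℝ), ∀ t : ℝ≥0, ‖S t‖ ≤ M * Real.exp (-r * t)

end Nonsimple

end

noncomputable section

namespace Nonsimple

/-! The only dissipation is thermal, so a motion that never excites the temperature is not damped.
The shear fields `u = (0, cos(n x₁))` with `τ = θ = 0` are of this kind. They are divergence-free,
so the heat equation does not see them, and their mixed derivatives vanish, so the first balance
equation is trivial. The second reduces to `ρ w² = μ n² + b₃ n⁴` (`force₂_waveDisp`, `freq_sq`); as
`a₃ + a₄ ≥ 0`, its right side is nonnegative and `w` is real. The boundary conditions hold for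
integer `n` because the only surviving boundary quantity is a multiple of `sin(n x₁)`
(`elasticBC_waveDisp`).

Thus `i w` is an eigenvalue (`isImage_wave`), and `exp(i w t)` times its eigenvector is a classical
solution of constant nonzero norm, which excludes exponential decay, also for any governing
semigroup. As `w → ∞` with `n`, eigenvectors scaled to norms tending to infinity give the resolvent
statement with `F = 0`.

The rest transfers this classical calculation to weak derivatives and weak traces:
`isWeakDeriv_toL2` and `vanishesOnΓ₂_toL2` are integrations by parts. -/

/-! ### Continuous functions as elements of `L²(Ω)` -/

lemma isFiniteMeasure_square : IsFiniteMeasure ((volume : Measure (ℝ × ℝ)).restrict Square) :=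
  isFiniteMeasure_restrict.2 (by
    rw [Square, Measure.volume_eq_prod, Measure.prod_prod]
    simp [ENNReal.mul_eq_top])

lemma isOpen_square : IsOpen Square := isOpen_Ioo.prod isOpen_Ioo

lemma integrableOn_square {f : ℝ × ℝ → ℂ} (hf : Continuous f) : IntegrableOn f Square :=
  (hf.continuousOn.integrableOn_compact (isCompact_Icc.prod isCompact_Icc)).mono_set
    (prod_mono Ioo_subset_Icc_self Ioo_subset_Icc_self)

lemma memLp_square {f : ℝ × ℝ → ℂ} (hf : Continuous f) :
    MemLp f 2 ((volume : Measure (ℝ × ℝ)).restrict Square) := by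
  have := isFiniteMeasure_square
  obtain ⟨C, hC⟩ := ((isCompact_Icc (a := (0 : ℝ)) (b := Real.pi)).prod
    (isCompact_Icc (a := (0 : ℝ)) (b := Real.pi))).exists_bound_of_continuousOn hf.continuousOn
  refine MemLp.of_bound hf.aestronglyMeasurable C ?_
  filter_upwards [ae_restrict_mem isOpen_square.measurableSet] with x hx
  exact hC x (prod_mono Ioo_subset_Icc_self Ioo_subset_Icc_self hx)

/-- The class in `L²(Ω)` of a continuous function. -/
def toL2 (f : ℝ × ℝ → ℂ) (hf : Continuous f) : L2 := (memLp_square hf).toLp f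

lemma coeFn_toL2 {f : ℝ × ℝ → ℂ} (hf : Continuous f) :
    toL2 f hf =ᵐ[volume.restrict Square] f := (memLp_square hf).coeFn_toLp

lemma integral_toL2_mul {f : ℝ × ℝ → ℂ} (hf : Continuous f) (φ : ℝ × ℝ → ℂ) :
    ∫ x in Square, toL2 f hf x * φ x = ∫ x in Square, f x * φ x := by
  refine integral_congr_ae ?_
  filter_upwards [coeFn_toL2 hf] with x hx
  rw [hx]

/-! ### Smooth functions as elements of the Sobolev spaces -/

/-- The classical derivative `∂^α f`, differentiating in `x₁` first. -/
def partials (α : ℕ × ℕ) (f : ℝ × ℝ → ℂ) : ℝ × ℝ → ℂ := (pd 1)^[α.2] ((pd 0)^[α.1] f)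

lemma contDiff_pd_iterate (i : Fin 2) (n : ℕ) {f : ℝ × ℝ → ℂ} (h : ContDiff ℝ ∞ f) :
    ContDiff ℝ ∞ ((pd i)^[n] f) := by
  induction n with
  | zero => exact h
  | succ n ih =>
    rw [Function.iterate_succ_apply']
    exact pd_contDiff i ih

lemma contDiff_partials (α : ℕ × ℕ) {f : ℝ × ℝ → ℂ} (h : ContDiff ℝ ∞ f) :
    ContDiff ℝ ∞ (partials α f) :=
  contDiff_pd_iterate 1 _ (contDiff_pd_iterate 0 _ h)

lemma integral_mul_pd (i : Fin 2) {f φ : ℝ × ℝ → ℂ} (hf : ContDiff ℝ ∞ f)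
    (hφ : ContDiff ℝ ∞ φ) (hc : HasCompactSupport φ) :
    ∫ x, f x * pd i φ x = - ∫ x, pd i f x * φ x :=
  integral_mul_fderiv_eq_neg_fderiv_mul_of_integrable
    (((pd_contDiff i hf).continuous.mul hφ.continuous).integrable_of_hasCompactSupport hc.mul_left)
    ((hf.continuous.mul (pd_contDiff i hφ).continuous).integrable_of_hasCompactSupport
      (pd_compact i hc).mul_left)
    ((hf.continuous.mul hφ.continuous).integrable_of_hasCompactSupport hc.mul_left)
    (fun x _ => hf.differentiable (by simp) x) (fun x _ => hφ.differentiable (by simp) x)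

lemma integral_mul_pd_iterate (i : Fin 2) (n : ℕ) {f φ : ℝ × ℝ → ℂ} (hf : ContDiff ℝ ∞ f)
    (hφ : ContDiff ℝ ∞ φ) (hc : HasCompactSupport φ) :
    ∫ x, f x * (pd i)^[n] φ x = (-1) ^ n * ∫ x, (pd i)^[n] f x * φ x := by
  induction n generalizing f with
  | zero => simp
  | succ n ih =>
    obtain ⟨h1, h2⟩ := pd_iter i n hφ hc
    rw [Function.iterate_succ_apply', integral_mul_pd i hf h1 h2, ih (pd_contDiff i hf),
      Function.iterate_succ_apply]
    ring

lemma tsupport_pd_iterate_subset (i : Fin 2) (n : ℕ) (φ : ℝ × ℝ → ℂ) :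
    tsupport ((pd i)^[n] φ) ⊆ tsupport φ := by
  induction n with
  | zero => exact subset_rfl
  | succ n ih =>
    rw [Function.iterate_succ_apply']
    exact (tsupport_fderiv_apply_subset ℝ (dir i)).trans ih

lemma setIntegral_mul_of_tsupport_subset (f : ℝ × ℝ → ℂ) {φ : ℝ × ℝ → ℂ}
    (h : tsupport φ ⊆ Square) : ∫ x in Square, f x * φ x = ∫ x, f x * φ x := by
  refine setIntegral_eq_integral_of_forall_compl_eq_zero fun x hx => ?_
  rw [image_eq_zero_of_notMem_tsupport fun hx' => hx (h hx'), mul_zero]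

/-- The support of `φ` lies in the open square, so the integrals extend to the plane and integration
by parts has no boundary terms. The outermost derivative of `pdMulti`, the one in `x₁`, moves first;
hence the reversed order in `partials`, which avoids commuting derivatives. -/
lemma isWeakDeriv_toL2 (α : ℕ × ℕ) {f : ℝ × ℝ → ℂ} (hf : ContDiff ℝ ∞ f) :
    IsWeakDeriv α (toL2 f hf.continuous)
      (toL2 (partials α f) (contDiff_partials α hf).continuous) := by
  intro φ hφ
  obtain ⟨h1, h2⟩ := pd_iter 1 α.2 hφ.1 hφ.2.1
  have hs : tsupport (pdMulti α φ) ⊆ Square := ((tsupport_pd_iterate_subset 0 _ _).trans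
    (tsupport_pd_iterate_subset 1 _ _)).trans hφ.2.2
  rw [integral_toL2_mul, integral_toL2_mul, setIntegral_mul_of_tsupport_subset _ hφ.2.2,
    setIntegral_mul_of_tsupport_subset _ hs]
  unfold pdMulti
  rw [integral_mul_pd_iterate 0 _ hf h1 h2,
    integral_mul_pd_iterate 1 _ (contDiff_pd_iterate 0 _ hf) hφ.1 hφ.2.1, pow_add, mul_assoc]
  rfl

/-- A smooth function as an element of `H^k(Ω)`. -/
def ofSmooth (k : ℕ) (f : ℝ × ℝ → ℂ) (hf : ContDiff ℝ ∞ f) : Sobolev k :=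
  ⟨WithLp.toLp 2 fun α => toL2 (partials ((α.1.1 : ℕ), (α.1.2 : ℕ)) f)
    (contDiff_partials _ hf).continuous, fun _ => isWeakDeriv_toL2 _ hf⟩

lemma D_ofSmooth {k : ℕ} {α : ℕ × ℕ} (h : α.1 + α.2 ≤ k) {f : ℝ × ℝ → ℂ} (hf : ContDiff ℝ ∞ f) :
    D α (ofSmooth k f hf) = toL2 (partials α f) (contDiff_partials α hf).continuous := by
  rw [D, dif_pos h]
  rfl

lemma D_smul {k : ℕ} (α : ℕ × ℕ) (z : ℂ) (f : Sobolev k) : D α (z • f) = z • D α f := by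
  unfold D
  split_ifs
  · rfl
  · rw [smul_zero]

lemma D_zero {k : ℕ} (α : ℕ × ℕ) : D α (0 : Sobolev k) = 0 := by
  simpa using D_smul α 0 (0 : Sobolev k)

lemma fn_smul {k : ℕ} (z : ℂ) (f : SobolevStar k) : fn (z • f) = z • fn f := rfl

/-! ### Vanishing boundary values of smooth functions -/

lemma vanishesOnΓ₁_zero : VanishesOnΓ₁ 0 0 := fun ψ _ => by
  rw [integral_zero_mul, integral_zero_mul, neg_zero]

lemma vanishesOnΓ₂_zero : VanishesOnΓ₂ 0 0 := fun ψ _ => by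
  rw [integral_zero_mul, integral_zero_mul, neg_zero]

lemma VanishesOnΓ₂.smul {f g : L2} (h : VanishesOnΓ₂ f g) (z : ℂ) :
    VanishesOnΓ₂ (z • f) (z • g) := fun ψ hψ => by
  rw [integral_smul_mul, integral_smul_mul, h ψ hψ, mul_neg]

lemma hasDerivAt_pd_zero {f : ℝ × ℝ → ℂ} (hf : ContDiff ℝ ∞ f) (s t : ℝ) :
    HasDerivAt (fun s => f (s, t)) (pd 0 f (s, t)) s := by
  have h := (hf.differentiable (by simp) (s, t)).hasFDerivAt
  exact h.comp_hasDerivAt s ((hasDerivAt_id s).prodMk (hasDerivAt_const s t))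

/-- Fubini reduces the claim to integration by parts on the segments `x₂ = t`; `ψ` may be nonzero at
their ends, but there `f` vanishes. -/
lemma vanishesOnΓ₂_toL2 {f : ℝ × ℝ → ℂ} (hf : ContDiff ℝ ∞ f) (h0 : ∀ t, f (0, t) = 0)
    (hpi : ∀ t, f (Real.pi, t) = 0) :
    VanishesOnΓ₂ (toL2 f hf.continuous) (toL2 (pd 0 f) (pd_contDiff 0 hf).continuous) := by
  intro ψ hψ
  have hψ' := (pd_contDiff 0 hψ.1).continuous
  have hf' := (pd_contDiff 0 hf).continuous
  have key : ∀ g h : ℝ × ℝ → ℂ, Continuous g → Continuous h → ∫ x in Square, g x * h x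
      = ∫ t in Ioo 0 Real.pi, ∫ s in (0 : ℝ)..Real.pi, g (s, t) * h (s, t) := by
    intro g h hg hh
    have hi : Integrable (fun x => g x * h x) ((volume.restrict (Ioo 0 Real.pi)).prod
        (volume.restrict (Ioo 0 Real.pi))) := by
      rw [Measure.prod_restrict]
      exact integrableOn_square (hg.mul hh)
    rw [Square, Measure.volume_eq_prod, ← Measure.prod_restrict, integral_prod_symm _ hi]
    refine integral_congr_ae (Eventually.of_forall fun t => ?_)
    simp only
    rw [intervalIntegral.integral_of_le Real.pi_pos.le, integral_Ioc_eq_integral_Ioo]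
  rw [integral_toL2_mul, integral_toL2_mul, key _ _ hf.continuous hψ',
    key _ _ hf' hψ.1.continuous, ← integral_neg]
  refine integral_congr_ae (Eventually.of_forall fun t => ?_)
  have hline : Continuous fun s : ℝ => (s, t) := by fun_prop
  simpa [h0, hpi] using intervalIntegral.integral_mul_deriv_eq_deriv_mul (a := 0) (b := Real.pi)
    (fun s _ => hasDerivAt_pd_zero hf s t) (fun s _ => hasDerivAt_pd_zero hψ.1 s t)
    ((hf'.comp hline).intervalIntegrable _ _) ((hψ'.comp hline).intervalIntegrable _ _)

/-! ### The transverse modes `u = (0, cos(n x₁))` -/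

lemma pd_one_comp_fst (g : ℝ → ℂ) : pd 1 (fun x => g x.1) = 0 := by
  funext x
  by_cases h : DifferentiableAt ℝ (fun x : ℝ × ℝ => g x.1) x
  · have h1 : HasDerivAt (fun t : ℝ => g (x.1, t).1) (pd 1 (fun x => g x.1) x) x.2 :=
      HasFDerivAt.comp_hasDerivAt (f := fun t : ℝ => (x.1, t)) x.2 h.hasFDerivAt
        ((hasDerivAt_const x.2 x.1).prodMk (hasDerivAt_id x.2))
    exact h1.unique (hasDerivAt_const x.2 (g x.1))
  -- At points of non-differentiability `fderiv` is `0` by convention, so `g` needs no regularity.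
  · simp [pd, fderiv_zero_of_not_differentiableAt h]

lemma pd_zero_comp_fst {g g' : ℝ → ℂ} (h : ∀ s, HasDerivAt g (g' s) s) :
    pd 0 (fun x => g x.1) = fun x => g' x.1 := by
  funext x
  have h1 := HasFDerivAt.comp x (h x.1).hasFDerivAt (hasFDerivAt_fst (𝕜 := ℝ) (p := x))
  have h2 : HasFDerivAt (fun x : ℝ × ℝ => g x.1) _ x := h1
  simp [pd, h2.fderiv, dir]

/-- The function `cos(n x₁)`. -/
def cosMode (n : ℝ) : ℝ × ℝ → ℂ := fun x => Complex.cos (n * (x.1 : ℝ))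

/-- The function `sin(n x₁)`. -/
def sinMode (n : ℝ) : ℝ × ℝ → ℂ := fun x => Complex.sin (n * (x.1 : ℝ))

lemma contDiff_cosMode (n : ℝ) : ContDiff ℝ ∞ (cosMode n) :=
  (Complex.contDiff_cos.restrict_scalars ℝ).comp
    (contDiff_const.mul (Complex.ofRealCLM.contDiff.comp contDiff_fst))

lemma contDiff_sinMode (n : ℝ) : ContDiff ℝ ∞ (sinMode n) :=
  (Complex.contDiff_sin.restrict_scalars ℝ).comp
    (contDiff_const.mul (Complex.ofRealCLM.contDiff.comp contDiff_fst))

lemma pd_smul (i : Fin 2) (z : ℂ) {f : ℝ × ℝ → ℂ} (hf : ContDiff ℝ ∞ f) :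
    pd i (z • f) = z • pd i f := by
  funext x
  simp [pd, fderiv_const_smul (hf.differentiable (by simp) x)]

lemma pd_zero_cosMode (n : ℝ) : pd 0 (cosMode n) = (-n : ℂ) • sinMode n := by
  refine (pd_zero_comp_fst (g := fun s => Complex.cos (n * s)) fun s =>
    ((((hasDerivAt_id (s : ℂ)).const_mul (n : ℂ)).ccos).comp_ofReal)).trans ?_
  funext x
  simp [sinMode, mul_comm]

lemma pd_zero_sinMode (n : ℝ) : pd 0 (sinMode n) = (n : ℂ) • cosMode n := by
  refine (pd_zero_comp_fst (g := fun s => Complex.sin (n * s)) fun s =>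
    ((((hasDerivAt_id (s : ℂ)).const_mul (n : ℂ)).csin).comp_ofReal)).trans ?_
  funext x
  simp [cosMode, mul_comm]

/-- What matters is only that every iterate is again a function of `x₁` alone, so that the next
derivative in `x₂` kills it. -/
lemma pd_zero_iterate_cosMode (n : ℝ) (j : ℕ) :
    ∃ z w : ℂ, (pd 0)^[j] (cosMode n) = fun x => z * cosMode n x + w * sinMode n x := by
  induction j with
  | zero => exact ⟨1, 0, by funext x; simp⟩
  | succ j ih =>
    obtain ⟨z, w, h⟩ := ih
    refine ⟨w * n, -(z * n), ?_⟩
    have hc := (contDiff_cosMode n).differentiable (by simp)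
    have hs := (contDiff_sinMode n).differentiable (by simp)
    have hc' := congrFun (pd_zero_cosMode n)
    have hs' := congrFun (pd_zero_sinMode n)
    rw [Function.iterate_succ_apply', h]
    funext x
    simp only [pd, Pi.smul_apply, smul_eq_mul] at hc' hs' ⊢
    rw [fderiv_fun_add ((hc x).const_mul z) ((hs x).const_mul w), fderiv_const_mul (hc x),
      fderiv_const_mul (hs x)]
    simp only [add_apply, smul_apply, smul_eq_mul, hc', hs']
    ring

lemma partials_cosMode_eq_zero (n : ℝ) (j l : ℕ) : partials (j, l + 1) (cosMode n) = 0 := by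
  obtain ⟨z, w, h⟩ := pd_zero_iterate_cosMode n j
  have h0 : ∀ l : ℕ, (pd 1)^[l] 0 = 0 := fun l =>
    Function.iterate_fixed (by funext x; simp [pd]) l
  rw [partials, Function.iterate_succ_apply, h]
  exact (congrArg _ (pd_one_comp_fst fun s =>
    z * Complex.cos (n * (s : ℝ)) + w * Complex.sin (n * (s : ℝ)))).trans (h0 l)

lemma pd_zero_iterate_two (n : ℝ) : (pd 0)^[2] (cosMode n) = (-n ^ 2 : ℂ) • cosMode n := by
  rw [Function.iterate_succ_apply, Function.iterate_one, pd_zero_cosMode,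
    pd_smul 0 _ (contDiff_sinMode n), pd_zero_sinMode, smul_smul]
  congr 1
  ring

lemma pd_zero_iterate_three (n : ℝ) : (pd 0)^[3] (cosMode n) = (n ^ 3 : ℂ) • sinMode n := by
  rw [Function.iterate_succ_apply', pd_zero_iterate_two, pd_smul 0 _ (contDiff_cosMode n),
    pd_zero_cosMode, smul_smul]
  congr 1
  ring

lemma pd_zero_iterate_four (n : ℝ) : (pd 0)^[4] (cosMode n) = (n ^ 4 : ℂ) • cosMode n := by
  rw [Function.iterate_succ_apply', pd_zero_iterate_three, pd_smul 0 _ (contDiff_sinMode n),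
    pd_zero_sinMode, smul_smul]
  congr 1

/-- `cos(n x₁)` in `L²(Ω)`. -/
def cosL2 (n : ℝ) : L2 := toL2 (cosMode n) (contDiff_cosMode n).continuous

/-- `cos(n x₁)` in `H^k(Ω)`. -/
def cosSobolev (k : ℕ) (n : ℝ) : Sobolev k := ofSmooth k (cosMode n) (contDiff_cosMode n)

lemma toL2_congr_smul {f g : ℝ × ℝ → ℂ} (hf : Continuous f) (hg : Continuous g) (z : ℂ)
    (h : f = z • g) : toL2 f hf = z • toL2 g hg := by
  subst h
  exact MemLp.toLp_const_smul z (memLp_square hg)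

lemma D_cosSobolev_of_snd_ne_zero (k : ℕ) (n : ℝ) {α : ℕ × ℕ} (h : α.2 ≠ 0) :
    D α (cosSobolev k n) = 0 := by
  obtain ⟨j, l⟩ := α
  obtain ⟨l, rfl⟩ := Nat.exists_eq_succ_of_ne_zero h
  by_cases hk : j + (l + 1) ≤ k
  · rw [cosSobolev, D_ofSmooth hk, toL2_congr_smul (g := cosMode n) _
      (contDiff_cosMode n).continuous 0 ?_, zero_smul]
    rw [zero_smul]
    exact partials_cosMode_eq_zero n j l
  -- Above order `k` the value of `D` is `0` by default, so no bound on `α` is needed.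
  · rw [D, dif_neg hk]

lemma D_cosSobolev_zero (k : ℕ) (n : ℝ) : D (0, 0) (cosSobolev k n) = cosL2 n :=
  D_ofSmooth (Nat.zero_le k) _

lemma D_cosSobolev_two {k : ℕ} (hk : 2 ≤ k) (n : ℝ) :
    D (2, 0) (cosSobolev k n) = (-n ^ 2 : ℂ) • cosL2 n :=
  (D_ofSmooth hk _).trans (toL2_congr_smul _ _ _ (pd_zero_iterate_two n))

lemma D_cosSobolev_four {k : ℕ} (hk : 4 ≤ k) (n : ℝ) :
    D (4, 0) (cosSobolev k n) = (n ^ 4 : ℂ) • cosL2 n :=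
  (D_ofSmooth hk _).trans (toL2_congr_smul _ _ _ (pd_zero_iterate_four n))

/-- The third derivative is `n³ sin(n x₁)`, which vanishes at `0` and, `n` being an integer, at `π`.
-/
lemma vanishesOnΓ₂_D_cosSobolev (n : ℕ) :
    VanishesOnΓ₂ (D (3, 0) (cosSobolev 4 n)) (D (4, 0) (cosSobolev 4 n)) := by
  have h3 := pd_zero_iterate_three n
  rw [cosSobolev, D_ofSmooth (by norm_num), D_ofSmooth (by norm_num)]
  have := vanishesOnΓ₂_toL2 (contDiff_partials (3, 0) (contDiff_cosMode n))
    (fun t => by simp [partials, h3, sinMode])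
    (fun t => by simp [partials, h3, sinMode, Complex.sin_nat_mul_pi])
  convert this using 2
  exact Function.iterate_succ_apply' (pd 0) 3 (cosMode n)

lemma integral_cosL2 {n : ℕ} (hn : n ≠ 0) : ∫ x in Square, cosL2 n x = 0 := by
  have hn' : (n : ℂ) ≠ 0 := Nat.cast_ne_zero.2 hn
  have h1 := setIntegral_prod_mul (μ := volume) (ν := volume)
    (fun s : ℝ => Complex.cos (n * (s : ℝ))) (fun _ : ℝ => (1 : ℂ)) (Ioo 0 Real.pi) (Ioo 0 Real.pi)
  have h2 : ∫ s in Ioo 0 Real.pi, Complex.cos (n * (s : ℝ)) = 0 := by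
    rw [← integral_Ioc_eq_integral_Ioo, ← intervalIntegral.integral_of_le Real.pi_pos.le,
      integral_cos_mul_complex hn']
    simp [Complex.sin_nat_mul_pi]
  rw [h2, zero_mul] at h1
  rw [cosL2, integral_congr_ae (coeFn_toL2 _), ← h1]
  simp [Square, cosMode, Measure.volume_eq_prod]

/-- A continuous function that is zero almost everywhere on the open square vanishes on its closure,
but the cosine is `1` at the corner `(0, 0)`. -/
lemma cosL2_ne_zero (n : ℝ) : cosL2 n ≠ 0 := by
  intro h
  have h1 : cosMode n =ᵐ[volume.restrict Square] 0 :=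
    (coeFn_toL2 (contDiff_cosMode n).continuous).symm.trans
      (by rw [show toL2 (cosMode n) _ = 0 from h]; exact Lp.coeFn_zero _ _ _)
  have h2 := Measure.eqOn_open_of_ae_eq h1 isOpen_square
    (contDiff_cosMode n).continuous.continuousOn continuousOn_const
  have h3 := h2.closure (contDiff_cosMode n).continuous continuous_const
  have h4 : ((0 : ℝ), (0 : ℝ)) ∈ closure Square := by
    rw [Square, closure_prod_eq, closure_Ioo Real.pi_pos.ne]
    exact ⟨⟨le_rfl, Real.pi_pos.le⟩, le_rfl, Real.pi_pos.le⟩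
  simpa [cosMode] using h3 h4

/-- `cos(n x₁)` in `H^k(Ω)/{1}`, for `n ≠ 0`. -/
def cosStar (k : ℕ) {n : ℕ} (hn : n ≠ 0) : SobolevStar k :=
  ⟨(cosSobolev k n).1, (cosSobolev k n).2, integral_cosL2 hn⟩

/-! ### Undamped transverse waves -/

/-- The frequency of the transverse wave `u = (0, cos(n x₁) exp(i w t))`. -/
def freq (c : Material) (n : ℝ) : ℝ := √((c.mu * n ^ 2 + c.b₃ * n ^ 4) / c.rho)

/-- The coefficients of `cos(n x₁)` in the state `(u, v, τ, θ)` of the transverse wave. -/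
def waveCoeff (w : ℝ) : Fin 6 → ℂ := ![0, 1, 0, Complex.I * w, 0, 0]

/-- The state of the transverse wave with wave number `n` at time `0`. -/
def wave (c : Material) {n : ℕ} (hn : n ≠ 0) : State :=
  WithLp.toLp 2 fun i => waveCoeff (freq c n) i • cosStar (order i) hn

lemma fn_smul_wave (c : Material) {n : ℕ} (hn : n ≠ 0) (z : ℂ) (i : Fin 6) :
    fn ((z • wave c hn) i) = (z * waveCoeff (freq c n) i) • cosL2 n := by
  rw [PiLp.smul_apply, fn_smul, mul_smul]
  rfl

lemma wave_ne_zero (c : Material) {n : ℕ} (hn : n ≠ 0) : wave c hn ≠ 0 := by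
  intro h
  -- The component `u₂` has coefficient `1`, whatever the frequency.
  have h1 := fn_smul_wave c hn 1 1
  rw [one_smul, h] at h1
  simp only [waveCoeff, Matrix.cons_val_one, Matrix.cons_val_zero, mul_one, one_smul] at h1
  exact cosL2_ne_zero n (h1.symm.trans rfl)

/-- The displacement of the transverse wave. -/
def waveDisp (k : ℕ) (n : ℝ) (z : ℂ) : Fin 2 → Sobolev k := ![0, z • cosSobolev k n]

lemma D_waveDisp_zero (k : ℕ) (n : ℝ) (z : ℂ) (α : ℕ × ℕ) : D α (waveDisp k n z 0) = 0 :=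
  D_zero α

lemma D_waveDisp_one (k : ℕ) (n : ℝ) (z : ℂ) (α : ℕ × ℕ) :
    D α (waveDisp k n z 1) = z • D α (cosSobolev k n) :=
  D_smul α z _

lemma D_waveDisp_one_of_snd_ne_zero (k : ℕ) (n : ℝ) (z : ℂ) {α : ℕ × ℕ} (h : α.2 ≠ 0) :
    D α (waveDisp k n z 1) = 0 := by
  rw [D_waveDisp_one, D_cosSobolev_of_snd_ne_zero k n h, smul_zero]

/-- The only nonzero second derivative is `κ₁₁₂ = u_{2,11}`. It is absent from `σ₁₁₁`, `σ₂₂₁` and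
`σ₁₂₂`, so only the condition on normal derivatives needs an argument. -/
lemma elasticBC_waveDisp (c : Material) (n : ℕ) (z : ℂ) : c.ElasticBC (waveDisp 4 n z) 0 := by
  have h : ∀ α : ℕ × ℕ, c.hyperstress (waveDisp 4 n z) 0 0 0 0 α = 0 ∧
      c.hyperstress (waveDisp 4 n z) 0 1 1 0 α = 0 ∧
      c.hyperstress (waveDisp 4 n z) 0 0 1 1 α = 0 := by
    intro α
    simp [Material.hyperstress, Material.kron, Material.e, D_waveDisp_zero, D_zero,
      D_waveDisp_one_of_snd_ne_zero]
  -- `σ₂₂₂` does contain `u_{2,11}`, but this depends on `x₁` alone and is killed by `∂₂`.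
  have h' : ∀ l : ℕ, l ≠ 0 → c.hyperstress (waveDisp 4 n z) 0 1 1 1 (0, l) = 0 := by
    intro l hl
    simp [Material.hyperstress, Material.kron, Material.e, D_waveDisp_zero, D_zero,
      D_waveDisp_one_of_snd_ne_zero, hl]
  -- In `σ₁₁₂` the trace term contributes `2 a₃` and the term `2 a₄ κ₁₁₂` the rest; one more
  -- `x₁`-derivative gives a multiple of the sine.
  have h'' : ∀ j : ℕ, c.hyperstress (waveDisp 4 n z) 0 0 0 1 (j, 0)
      = ((2 * c.a₃ + 2 * c.a₄ : ℝ) * z : ℂ) • D (j + 2, 0) (cosSobolev 4 n) := by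
    intro j
    simp [Material.hyperstress, Material.kron, Material.e, D_waveDisp_zero, D_zero,
      D_waveDisp_one_of_snd_ne_zero, add_assoc,
      D_waveDisp_one, D_cosSobolev_of_snd_ne_zero, RCLike.real_smul_eq_coe_smul (K := ℂ)]
    module
  simp only [Material.ElasticBC, (h _).1, (h _).2.1, (h _).2.2, h' 1 one_ne_zero, h' 2 two_ne_zero,
    h'', vanishesOnΓ₁_zero, vanishesOnΓ₂_zero, true_and]
  exact (vanishesOnΓ₂_D_cosSobolev n).smul _

lemma force₁_waveDisp (c : Material) (n : ℝ) (z : ℂ) : c.force₁ (waveDisp 4 n z) 0 0 = 0 := by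
  simp [Material.force₁, D_waveDisp_zero, D_zero, D_waveDisp_one_of_snd_ne_zero]

/-- Only `μ u_{2,11}` and `b₃ u_{2,1111}` survive, since all other terms contain an `x₂`-derivative,
`u₁` or the temperature. -/
lemma force₂_waveDisp (c : Material) (n : ℝ) (z : ℂ) : c.force₂ (waveDisp 4 n z) 0 0
    = (-(c.mu * n ^ 2 + c.b₃ * n ^ 4 : ℝ) * z : ℂ) • cosL2 n := by
  simp only [Material.force₂, D_waveDisp_zero, D_zero, D_waveDisp_one_of_snd_ne_zero, ne_eq,
    OfNat.ofNat_ne_zero, not_false_eq_true, D_waveDisp_one, le_refl,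
    D_cosSobolev_two (k := 4) (by norm_num), D_cosSobolev_four,
    RCLike.real_smul_eq_coe_smul (K := ℂ), smul_zero]
  push_cast
  module

/-- The coupling terms are `Δ div u` and `div v`, and both fields are divergence-free. -/
lemma heat_waveDisp (c : Material) (n : ℝ) (z w : ℂ) :
    c.heat (waveDisp 4 n z) (waveDisp 2 n w) 0 0 = 0 := by
  simp [Material.heat, D_waveDisp_zero, D_zero, D_waveDisp_one_of_snd_ne_zero]

lemma thermalBC_zero (k : ℕ) : Material.ThermalBC (0 : Sobolev k) := by
  simp only [Material.ThermalBC, D_zero]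
  exact ⟨vanishesOnΓ₁_zero, vanishesOnΓ₂_zero⟩

/-- The dispersion relation. The sign of `a₃ + a₄` enters here: it makes the radicand nonnegative,
so that the real square root does not degenerate. -/
lemma freq_sq {c : Material} (hrho : 0 < c.rho) (hmu : 0 < c.mu) (h34 : 0 ≤ c.a₃ + c.a₄) (n : ℝ) :
    c.rho * freq c n ^ 2 = c.mu * n ^ 2 + c.b₃ * n ^ 4 := by
  have hb : 0 ≤ c.b₃ := mul_nonneg two_pos.le h34
  rw [freq, Real.sq_sqrt (by positivity)]
  field_simp

/-- The transverse wave is an eigenvector of the operator, with eigenvalue `i w`. -/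
lemma isImage_wave {c : Material} (hrho : 0 < c.rho) (hmu : 0 < c.mu) (h34 : 0 ≤ c.a₃ + c.a₄)
    {n : ℕ} (hn : n ≠ 0) (z : ℂ) :
    IsImage c (z • wave c hn) ((Complex.I * freq c n * z) • wave c hn) := by
  have hw : (c.rho : ℂ) * (freq c n : ℂ) ^ 2 = ((c.mu * n ^ 2 + c.b₃ * n ^ 4 : ℝ) : ℂ) := by
    exact_mod_cast freq_sq hrho hmu h34 n
  have hrho' : (c.rho : ℂ) ≠ 0 := Complex.ofReal_ne_zero.2 hrho.ne'
  -- The factor `i w` in the velocity comes from `v = u̇`.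
  refine ⟨waveDisp 4 n z, waveDisp 2 n (z * (Complex.I * freq c n)), 0, 0, ?_,
    elasticBC_waveDisp c n z, thermalBC_zero 3, thermalBC_zero 2, ?_⟩
  · simp only [fn_smul_wave, D_waveDisp_zero, D_waveDisp_one, D_zero, D_cosSobolev_zero]
    simp [waveCoeff]
  · simp only [fn_smul_wave, D_waveDisp_zero, D_waveDisp_one, D_zero, D_cosSobolev_zero,
      force₁_waveDisp, force₂_waveDisp, heat_waveDisp, ← hw]
    refine ⟨by simp [waveCoeff], ?_, by simp [waveCoeff], ?_, by simp [waveCoeff],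
      by simp [waveCoeff]⟩
    · congr 1
      simp [waveCoeff]
      ring
    · rw [RCLike.real_smul_eq_coe_smul (K := ℂ), smul_smul]
      congr 1
      simp [waveCoeff]
      field_simp
      -- After division by `ρ`, the second balance equation is `(i w)² = -w²`.
      linear_combination (freq c n ^ 2 * z : ℂ) * Complex.I_sq

/-- The real scalar action is only assumed compatible with the complex one. Writing `r • y = (r • 1
: ℂ) • y` gives the real norm bound, and the product rule applies. -/
lemma hasDerivWithinAt_smul_of_isScalarTower {E : Type*} [NormedAddCommGroup E] [NormedSpace ℂ E]
    [Module ℝ E] [IsScalarTower ℝ ℂ E] [ContinuousSMul ℝ E] {f : ℝ → ℂ} {f' : ℂ}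
    {s : Set ℝ} {t : ℝ} (h : HasDerivAt f f' t) (x : E) :
    HasDerivWithinAt (fun t => f t • x) (f' • x) s t := by
  let : NormedSpace ℝ E :=
    { ‹Module ℝ E› with
      norm_smul_le := fun r y => by
        rw [← smul_one_smul ℂ r y, norm_smul, norm_smul, norm_one, mul_one] }
  exact (h.smul_const x).hasDerivWithinAt

/-- The transverse waves `exp(i w t) (0, cos(n x₁), 0, i w cos(n x₁), 0, 0)` are classical
solutions. -/
lemma isClassicalSolution_wave {c : Material} (hrho : 0 < c.rho) (hmu : 0 < c.mu)
    (h34 : 0 ≤ c.a₃ + c.a₄) {n : ℕ} (hn : n ≠ 0) :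
    IsClassicalSolution c fun t => Complex.exp (Complex.I * freq c n * t) • wave c hn := by
  refine ⟨fun t => (Complex.I * freq c n * Complex.exp (Complex.I * freq c n * t)) • wave c hn,
    by fun_prop, fun t _ => ⟨?_, isImage_wave hrho hmu h34 hn _⟩⟩
  have h := (((hasDerivAt_id (t : ℂ)).const_mul (Complex.I * freq c n)).cexp).comp_ofReal
  exact hasDerivWithinAt_smul_of_isScalarTower (by simpa [mul_comm] using h) (wave c hn)

lemma norm_wave_time (c : Material) {n : ℕ} (hn : n ≠ 0) (t : ℝ) :
    ‖Complex.exp (Complex.I * freq c n * t) • wave c hn‖ = ‖wave c hn‖ := by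
  rw [norm_smul, Complex.norm_exp]
  simp

/-! ### Failure of exponential stability -/

/-- One wave, `n = 1`, suffices: its norm is constant and positive, while the supposed bound tends
to zero. -/
lemma not_systemExpStable {c : Material} (hrho : 0 < c.rho) (hmu : 0 < c.mu)
    (h34 : 0 ≤ c.a₃ + c.a₄) : ¬ SystemExpStable c := by
  rintro ⟨M, -, r, hr, h⟩
  have hpos : 0 < ‖wave c one_ne_zero‖ := norm_pos_iff.2 (wave_ne_zero c one_ne_zero)
  have hlim : Tendsto (fun t : ℝ => M * Real.exp (-r * t) * ‖wave c one_ne_zero‖) atTop (𝓝 0) := by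
    have h1 : Tendsto (fun t : ℝ => Real.exp (-r * t)) atTop (𝓝 0) :=
      Real.tendsto_exp_atBot.comp (tendsto_id.const_mul_atTop_of_neg (neg_lt_zero.2 hr))
    simpa using (h1.const_mul M).mul_const ‖wave c one_ne_zero‖
  refine hpos.not_ge (ge_of_tendsto hlim ?_)
  filter_upwards [eventually_ge_atTop 0] with t ht
  have h2 := h _ (isClassicalSolution_wave hrho hmu h34 one_ne_zero) t ht
  rwa [norm_wave_time, norm_wave_time] at h2

/-- Classical solutions are orbits of `S`, so the operator norm bound passes to them; this reduces
the semigroup statement to the one on solutions. -/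
lemma ExpStable.systemExpStable {c : Material} {S : ℝ≥0 → State →L[ℂ] State} (hS : ExpStable S)
    (hg : GovernsSystem c S) : SystemExpStable c := by
  obtain ⟨M, hM, r, hr, h⟩ := hS
  refine ⟨M, hM, r, hr, fun U hU t ht => ?_⟩
  rw [show U t = S ⟨t, ht⟩ (U 0) from hg U hU ⟨t, ht⟩]
  exact (S ⟨t, ht⟩).le_of_opNorm_le (h ⟨t, ht⟩) (U 0)

/-! ### High frequencies and the resolvent condition -/

/-- Dropping the nonnegative `b₃` term from the radicand leaves linear growth due to `μ` alone,
which also covers `a₃ + a₄ = 0`. -/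
lemma le_freq {c : Material} (hrho : 0 < c.rho) (h34 : 0 ≤ c.a₃ + c.a₄) {n : ℝ} (hn : 0 ≤ n) :
    √(c.mu / c.rho) * n ≤ freq c n := by
  have hb : 0 ≤ c.b₃ := mul_nonneg two_pos.le h34
  rw [← Real.sqrt_sq hn, ← Real.sqrt_mul' _ (sq_nonneg n), Real.sqrt_sq hn]
  refine Real.sqrt_le_sqrt ?_
  rw [div_mul_eq_mul_div]
  gcongr
  exact le_add_of_nonneg_right (by positivity)

lemma tendsto_abs_freq {c : Material} (hrho : 0 < c.rho) (hmu : 0 < c.mu)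
    (h34 : 0 ≤ c.a₃ + c.a₄) :
    -- The shift skips `n = 0`, the constant mode, which does not have mean zero.
    Tendsto (fun n : ℕ => |freq c (n + 1 : ℕ)|) atTop atTop := by
  refine tendsto_atTop_mono (fun n => (le_freq hrho h34 (Nat.cast_nonneg _)).trans (le_abs_self _))
    (Tendsto.const_mul_atTop (Real.sqrt_pos.2 (div_pos hmu hrho)) ?_)
  exact tendsto_natCast_atTop_atTop.comp (tendsto_add_atTop_nat 1)

/-- Any multiple of an eigenvector is admissible in the resolvent condition with `F = 0`; this
scaling makes the norm equal to `n + 1`. -/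
lemma tendsto_norm_scaled_wave (c : Material) :
    Tendsto (fun n : ℕ => ‖((n + 1 : ℕ) / ‖wave c n.succ_ne_zero‖ : ℂ) • wave c n.succ_ne_zero‖)
      atTop atTop := by
  have h : ∀ n : ℕ, ‖((n + 1 : ℕ) / ‖wave c n.succ_ne_zero‖ : ℂ) • wave c n.succ_ne_zero‖
      = ((n + 1 : ℕ) : ℝ) := fun n => by
    rw [norm_smul, norm_div, Complex.norm_natCast, Complex.norm_real, norm_norm,
      div_mul_cancel₀ _ (norm_ne_zero_iff.2 (wave_ne_zero c n.succ_ne_zero))]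
  simp only [h]
  exact tendsto_natCast_atTop_atTop.comp (tendsto_add_atTop_nat 1)

end Nonsimple

end

/-- If `a₃ + a₄ ≥ 0`, the divergence-free fields `u = (0, cos(n x₁))` decouple from the temperature
and satisfy the boundary conditions; they oscillate without damping.  Hence `i w` is an eigenvalue
of the operator for each of their frequencies `w`, and no decay is possible; the resolvent
condition fails with `F = 0` and multiples of the eigenvectors. -/
theorem mainTheorem3 (c : Nonsimple.Material)
    (hrho : 0 < c.rho) (ha : 0 < c.a) (hmu : 0 < c.mu) (hdelta : 0 < c.delta)
    (h34 : 0 ≤ c.a₃ + c.a₄) :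
    ¬ Nonsimple.SystemExpStable c ∧
    (∀ S : ℝ≥0 → Nonsimple.State →L[ℂ] Nonsimple.State,
      Nonsimple.IsC0Semigroup S → Nonsimple.GovernsSystem c S → ¬ Nonsimple.ExpStable S) ∧
    (∃ (l : ℕ → ℝ) (U F : ℕ → Nonsimple.State),
      Tendsto (fun n => |l n|) atTop atTop ∧
      (∀ n, Nonsimple.IsImage c (U n) ((Complex.I * (l n : ℂ)) • U n - F n)) ∧
      (∃ C : ℝ, ∀ n, ‖F n‖ ≤ C) ∧
      Tendsto (fun n => ‖U n‖) atTop atTop) := by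
  open Nonsimple in
  refine ⟨not_systemExpStable hrho hmu h34,
    fun S _ hg hS => not_systemExpStable hrho hmu h34 (hS.systemExpStable hg),
    fun n => freq c (n + 1 : ℕ),
    fun n => ((n + 1 : ℕ) / ‖wave c n.succ_ne_zero‖ : ℂ) • wave c n.succ_ne_zero, fun _ => 0,
    tendsto_abs_freq hrho hmu h34, fun n => ?_, ⟨0, fun n => norm_zero.le⟩,
    tendsto_norm_scaled_wave c⟩
  -- With `F = 0` the resolvent equation is the eigenvalue equation of the scaled wave.
  rw [sub_zero, smul_smul]
  exact isImage_wave hrho hmu h34 n.succ_ne_zero _
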